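/- Let $p$ be a prime, $m\ge 1$, $q=p^m$, let $\mathbb F_q$ be the field with $q$ elements and $\mathcal R=\mathbb F_q+u\mathbb F_q$ with $u^2=u$. Put $\xi_1=1-u$, $\xi_2=u$, so that every $r=a+ub\in\mathcal R$ is uniquely $r=\xi_1r_1+\xi_2r_2$ with $r_1=a,\ r_2=a+b\in\mathbb F_q$. Fix $i\ge 0$ and let $\Theta(a)=a^{p^i}$ on $\mathbb F_q$ and $\theta(a+ub)=\Theta(a)+u\,\Theta(b)$ on $\mathcal R$. In the skew polynomial ring $\mathbb F_q[x;\Theta]$ multiplication is given by $(ax^s)(bx^t)=a\,\Theta^s(b)\,x^{s+t}$. For $h=h_0+h_1x+\dots+h_dx^d$ of degree $d$ put $$h^\dagger=h_d+\Theta(h_{d-1})x+\dots+\Theta^d(h_0)x^d .$$ A word $(c_0,\dots,c_{n-1})\in\mathbb F_q^n$ is identified with $c_0+c_1x+\dots+c_{n-1}x^{n-1}$; a linear code $D\subseteq\mathbb F_q^n$ is generated by $g$, written $D=\langle g\rangle$, if under this identification it is the left $\mathbb F_q[x;\Theta]$-submodule of $\mathbb F_q[x;\Theta]/\langle x^n-1\rangle$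 generated by the class of $g$. The ring $\mathcal R$ acts on $\mathbb F_q^\alpha\times\mathcal R^\beta$ by $(a+ub)*(x,y)=(ax,(a+ub)y)$. An $\mathbb F_q\mathcal R$-skew cyclic code of length $(\alpha,\beta)$ is an $\mathcal R$-submodule of $\mathbb F_q^\alpha\times\mathcal R^\beta$ closed under $$(x_0,\dots,x_{\alpha-1},y_0,\dots,y_{\beta-1})\mapsto(\Theta(x_{\alpha-1}),\Theta(x_0),\dots,\Theta(x_{\alpha-2}),\theta(y_{\beta-1}),\theta(y_0),\dots,\theta(y_{\beta-2})).$$ Let $M$ be a $2\times2$ matrix over $\mathbb F_q$ with $MM^T=\gamma I_2$, $\gamma\ne0$, and let $\varphi:\mathbb F_q^\alpha\times\mathcal R^\beta\to\mathbb F_q^{\alpha+2\beta}$ be the Gray map that is the identity on $\mathbb F_q^\alpha$ and sends each coordinate $r=\xi_1r_1+\xi_2r_2\in\mathcal R$ to $(r_1,r_2)M$. A quantum code $[[n,K,d]]_q$ is a $q^K$-dimensional subspace $Q$ of $(\mathbb C^q)^{\otimes n}$ of minimum distance at least $d$: if $P$ is the orthogonal projection onto $Q$, then for every operator $E$ acting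 on fewer than $d$ of the $n$ tensor factors there is a scalar $c_E$ with $PEP=c_EP$; if $K=0$, one requires in addition, as usual, that $c_E=q^{-n}\operatorname{tr}E$. Its minimum distance is exactly $d$ if this fails with $d+1$ in place of $d$. **Theorem.** Suppose that the order of $\Theta$ divides $\alpha$ and the order of $\theta$ divides $\beta$. Let $\mathcal C=\mathcal C'\otimes\mathscr C=\{(x,y):x\in\mathcal C',\,y\in\mathscr C\}$ be a separable $\mathbb F_q\mathcal R$-skew cyclic code of length $(\alpha,\beta)$, where $\mathcal C'=\langle f\rangle\subseteq\mathbb F_q^\alpha$ and $\mathscr C=\xi_1\mathcal C_1\oplus\xi_2\mathcal C_2\subseteq\mathcal R^\beta$ with $$\mathcal C_1=\{\mathbf a:\mathbf a+u\mathbf b\in\mathscr C\text{ for some }\mathbf b\}=\langle g_1\rangle,\qquad \mathcal C_2=\{\mathbf a+\mathbf b:\mathbf a+u\mathbf b\in\mathscr C\}=\langle g_2\rangle ,$$ and suppose that $x^\alpha-1=h f$ and $x^\beta-1=h_jg_j$ $(j=1,2)$ in $\mathbb F_q[x;\Theta]$. If $h^\dagger h$ is divisible by $x^\alpha-1$ from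 the right side (that is, $h^\dagger h=t\,(x^\alpha-1)$ for some $t$) and $h_j^\dagger h_j$ is divisible by $x^\beta-1$ from the right side for $j=1,2$, then $2k\ge\alpha+2\beta$ and there exists a quantum code $$[[\alpha+2\beta,\;2k-(\alpha+2\beta),\;d_H]]_q ,$$ where $k$ is the dimension and $d_H$ the minimum Hamming distance of $\varphi(\mathcal C)$. Moreover the quantum code can be chosen so that its minimum distance is exactly $d_H$ whenever $\varphi(\mathcal C)$ is nonzero and equal to its Euclidean dual, or some codeword of $\varphi(\mathcal C)$ of weight $d_H$ does not lie in the Euclidean dual of $\varphi(\mathcal C)$. (The minimum distance of the zero code, which occurs only for $\alpha=\beta=0$, is read as $0$.) -/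

import Mathlib

namespace SkewCode

noncomputable section

/-! ### The ring `𝓡 = F + uF`, `u² = u`, and its automorphism `θ` -/

/-- The ring `𝓡 = F + uF` with `u² = 0 + 1 · u = u`. The element `a + ub` is `⟨a, b⟩`, i.e. `re` is
the coefficient `a` and `im` is the coefficient `b`. -/
abbrev MixedRing (F : Type*) [Field F] : Type _ := QuadraticAlgebra F 0 1

/-- The automorphism `θ(a + ub) = Θ(a) + u Θ(b)` of `𝓡`. -/
def thetaAut {F : Type*} [Field F] (Θ : RingAut F) : RingAut (MixedRing F) where
  toFun r := ⟨Θ r.re, Θ r.im⟩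
  invFun r := ⟨Θ.symm r.re, Θ.symm r.im⟩
  left_inv r := by ext <;> simp
  right_inv r := by ext <;> simp
  map_mul' r s := by ext <;> simp
  map_add' r s := by ext <;> simp

/-- The ring homomorphism `η : 𝓡 → F`, `η(a + ub) = a`. -/
def eta (F : Type*) [Field F] : MixedRing F →+* F where
  toFun r := r.re
  map_one' := rfl
  map_zero' := rfl
  map_mul' r s := by simp
  map_add' r s := rfl

/-- `𝓡` acts on `F` through `η`. With the product and function instances of Mathlib this makes
`F^α × 𝓡^β` an `𝓡`-module under `s * (x, y) = (η(s) x, s y)`. -/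
instance mixedModule (F : Type*) [Field F] : Module (MixedRing F) F :=
  Module.compHom F (eta F)

theorem mixed_smul_def {F : Type*} [Field F] (s : MixedRing F) (x : F) : s • x = s.re * x := rfl

instance mixedTower (F : Type*) [Field F] : IsScalarTower F (MixedRing F) F where
  smul_assoc a s x := by simp [mixed_smul_def, mul_assoc]

/-- The ambient space `F^α × 𝓡^β`. -/
abbrev MixedSpace (F : Type*) [Field F] (α β : ℕ) : Type _ :=
  (Fin α → F) × (Fin β → MixedRing F)

/-! ### Skew polynomials -/

/-- A copy of the field `F` on which `Multiplicative ℕ` acts through the powers of `Θ`. -/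
def Twisted {F : Type*} [Field F] (_Θ : RingAut F) : Type _ := F

instance {F : Type*} [Field F] (Θ : RingAut F) : Field (Twisted Θ) := inferInstanceAs (Field F)

/-- The identity map from `F` to its copy. -/
def toTwisted {F : Type*} [Field F] (Θ : RingAut F) : F ≃+* Twisted Θ := RingEquiv.refl F

/-- The generator of `Multiplicative ℕ` acts as `Θ`, so that `n` acts as `Θⁿ`. -/
instance {F : Type*} [Field F] (Θ : RingAut F) :
    MulSemiringAction (Multiplicative ℕ) (Twisted Θ) where
  smul n a := toTwisted Θ ((Θ ^ n.toAdd : RingAut F) ((toTwisted Θ).symm a))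
  one_smul _ := rfl
  mul_smul m n a := by
    change (Θ ^ (m.toAdd + n.toAdd) : RingAut F) a = _
    rw [pow_add]; rfl
  smul_zero n := map_zero (Θ ^ n.toAdd : RingAut F)
  smul_add n := map_add (Θ ^ n.toAdd : RingAut F)
  smul_one n := map_one (Θ ^ n.toAdd : RingAut F)
  smul_mul n := map_mul (Θ ^ n.toAdd : RingAut F)

theorem twisted_smul_def {F : Type*} [Field F] (Θ : RingAut F) (n : ℕ) (a : F) :
    Multiplicative.ofAdd n • toTwisted Θ a = toTwisted Θ ((Θ ^ n : RingAut F) a) := rfl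

/-- The skew polynomial ring `F[x; Θ]`, with `(a xⁱ)(b xʲ) = a Θⁱ(b) xⁱ⁺ʲ`. -/
abbrev SkewPoly {F : Type*} [Field F] (Θ : RingAut F) : Type _ := SkewPolynomial (Twisted Θ)

/-- The skew polynomial `xⁿ - 1`. -/
def xPowSubOne {F : Type*} [Field F] (Θ : RingAut F) (n : ℕ) : SkewPoly Θ :=
  SkewPolynomial.X ^ n - 1

/-- The degree of a skew polynomial, with value `0` at the zero polynomial. -/
def skewDegree {F : Type*} [Field F] {Θ : RingAut F} (h : SkewPoly Θ) : ℕ :=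
  (SkewPolynomial.support h).sup id

/-- `h†(x) = h_d + Θ(h_{d-1}) x + ⋯ + Θᵈ(h_0) xᵈ` for `h(x) = h_0 + h_1 x + ⋯ + h_d xᵈ` of
degree `d`. -/
def dagger {F : Type*} [Field F] {Θ : RingAut F} (h : SkewPoly Θ) : SkewPoly Θ :=
  ∑ j ∈ Finset.range (skewDegree h + 1),
    SkewPolynomial.monomial j (toTwisted Θ
      ((Θ ^ j : RingAut F) ((toTwisted Θ).symm (SkewPolynomial.coeff h (skewDegree h - j)))))

/-- The polynomial `c_0 + c_1 x + ⋯ + c_{n-1} xⁿ⁻¹` of a word `c`. -/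
def wordPoly {F : Type*} [Field F] (Θ : RingAut F) {n : ℕ} (c : Fin n → F) : SkewPoly Θ :=
  ∑ j : Fin n, SkewPolynomial.monomial (j : ℕ) (toTwisted Θ (c j))

/-- `D = ⟨g(x)⟩`: the words of `D` are those whose polynomial lies, modulo the left ideal
generated by `xⁿ - 1`, in the left `F[x; Θ]`-submodule generated by `g`. -/
def IsGeneratedBy {F : Type*} [Field F] (Θ : RingAut F) {n : ℕ}
    (D : Submodule F (Fin n → F)) (g : SkewPoly Θ) : Prop :=
  ∀ c : Fin n → F, c ∈ D ↔
    (Submodule.Quotient.mk (wordPoly Θ c) :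
        SkewPoly Θ ⧸ (Submodule.span (SkewPoly Θ) {xPowSubOne Θ n})) ∈
      Submodule.span (SkewPoly Θ)
        {(Submodule.Quotient.mk g : SkewPoly Θ ⧸ (Submodule.span (SkewPoly Θ) {xPowSubOne Θ n}))}

/-! ### Skew cyclic codes -/

/-- The skew cyclic shift `(c_0, …, c_{n-1}) ↦ (τ c_{n-1}, τ c_0, …, τ c_{n-2})`. -/
def skewShift {A : Type*} (τ : A → A) {n : ℕ} (c : Fin n → A) : Fin n → A :=
  fun j => τ (c ((finRotate n).symm j))

/-- An `F𝓡`-linear code of length `(α, β)` (an `𝓡`-submodule of `F^α × 𝓡^β`) is skew cyclic if it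
is closed under the skew cyclic shift `σ`, acting by `Θ` on the first block and by `θ` on the
second. -/
def IsMixedSkewCyclic {F : Type*} [Field F] (Θ : RingAut F) {α β : ℕ}
    (C : Submodule (MixedRing F) (MixedSpace F α β)) : Prop :=
  ∀ c ∈ C, ((skewShift Θ c.1, skewShift (thetaAut Θ) c.2) : MixedSpace F α β) ∈ C

/-- The code `𝒞₁ = {a : a + ub ∈ 𝒞 for some b}` of a code `𝒞` over `𝓡`. -/
def componentOne {F : Type*} [Field F] {n : ℕ}
    (D : Submodule (MixedRing F) (Fin n → MixedRing F)) : Submodule F (Fin n → F) where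
  carrier := {a | ∃ r ∈ D, a = fun j => (r j).re}
  zero_mem' := ⟨0, D.zero_mem, rfl⟩
  add_mem' := by
    rintro _ _ ⟨r, hr, rfl⟩ ⟨s, hs, rfl⟩
    exact ⟨r + s, D.add_mem hr hs, rfl⟩
  smul_mem' := by
    rintro t _ ⟨r, hr, rfl⟩
    refine ⟨algebraMap F (MixedRing F) t • r, D.smul_mem _ hr, ?_⟩
    ext j; simp

/-- The code `𝒞₂ = {a + b : a + ub ∈ 𝒞}` of a code `𝒞` over `𝓡`. -/
def componentTwo {F : Type*} [Field F] {n : ℕ}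
    (D : Submodule (MixedRing F) (Fin n → MixedRing F)) : Submodule F (Fin n → F) where
  carrier := {a | ∃ r ∈ D, a = fun j => (r j).re + (r j).im}
  zero_mem' := ⟨0, D.zero_mem, by ext; simp⟩
  add_mem' := by
    rintro _ _ ⟨r, hr, rfl⟩ ⟨s, hs, rfl⟩
    refine ⟨r + s, D.add_mem hr hs, ?_⟩
    ext j; simp; ring
  smul_mem' := by
    rintro t _ ⟨r, hr, rfl⟩
    refine ⟨algebraMap F (MixedRing F) t • r, D.smul_mem _ hr, ?_⟩
    ext j; simp [mul_add]

/-! ### The Gray map -/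

/-- The Gray map `F^α × 𝓡^β → F^(α + 2β)`: the identity on the first block, and
`r = ξ₁ r₁ + ξ₂ r₂ ↦ (r₁, r₂) M` on every coordinate of the second block, where `ξ₁ = 1 - u` and
`ξ₂ = u`; the coordinates of `r = a + ub` in this basis are `r₁ = a` and `r₂ = a + b`. -/
def grayMap {F : Type*} [Field F] (M : Matrix (Fin 2) (Fin 2) F) (α β : ℕ) :
    MixedSpace F α β →ₗ[F] ((Fin α ⊕ Fin β × Fin 2) → F) where
  toFun c := Sum.elim c.1
    (fun jl => Matrix.vecMul ![(c.2 jl.1).re, (c.2 jl.1).re + (c.2 jl.1).im] M jl.2)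
  map_add' c d := by
    funext i
    rcases i with i | ⟨j, l⟩
    · simp
    · simp [Matrix.vecMul, dotProduct, Fin.sum_univ_two]; ring
  map_smul' t c := by
    funext i
    rcases i with i | ⟨j, l⟩
    · simp
    · simp [Matrix.vecMul, dotProduct, Fin.sum_univ_two]; ring

/-- The Gray image of an `F𝓡`-linear code, as a linear code over `F`. -/
def grayImage {F : Type*} [Field F] (M : Matrix (Fin 2) (Fin 2) F) {α β : ℕ}
    (C : Submodule (MixedRing F) (MixedSpace F α β)) :
    Submodule F ((Fin α ⊕ Fin β × Fin 2) → F) :=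
  (C.restrictScalars F).map (grayMap M α β)

/-- The minimum Hamming distance of a linear code: the least distance of two distinct words
(with value `0` for the zero code). -/
def minDist {F : Type*} [Field F] [DecidableEq F] {ι : Type*} [Fintype ι]
    (D : Submodule F (ι → F)) : ℕ :=
  sInf {d | ∃ c ∈ D, ∃ c' ∈ D, c ≠ c' ∧ hammingDist c c' = d}

/-- The Euclidean dual code. -/
def dualCode {F : Type*} [Field F] {ι : Type*} [Fintype ι]
    (D : Submodule F (ι → F)) : Submodule F (ι → F) where
  carrier := {c | ∀ c' ∈ D, dotProduct c c' = 0}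
  zero_mem' := by intro c' _; simp
  add_mem' := by
    intro a b ha hb c' hc'
    rw [add_dotProduct, ha c' hc', hb c' hc', add_zero]
  smul_mem' := by
    intro t a ha c' hc'
    rw [smul_dotProduct, ha c' hc', smul_zero]

/-! ### Quantum codes -/

/-- The state space `(ℂ^q)^{⊗n}` in coordinates with respect to the standard orthonormal product
basis, which is indexed by the words of length `n` over `q` symbols. The inner product of `v` and
`w` is `star v ⬝ᵥ w`. -/
abbrev QState (q n : ℕ) : Type := (Fin n → Fin q) → ℂ

/-- The operator `E` acts only on the tensor factors in `S`: `E = A ⊗ id` for an operator `A` on the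
factors in `S`. -/
def ActsOn {q n : ℕ} (S : Finset (Fin n)) (E : Matrix (Fin n → Fin q) (Fin n → Fin q) ℂ) : Prop :=
  ∃ A : Matrix (S → Fin q) (S → Fin q) ℂ, ∀ x y : Fin n → Fin q,
    ((∀ i, i ∉ S → x i = y i) → E x y = A (fun i => x i) (fun i => y i)) ∧
    ((∃ i, i ∉ S ∧ x i ≠ y i) → E x y = 0)

/-- The code `Q` detects the error `E`, i.e. `P E P = c P` for a scalar `c`, where `P` is the
orthogonal projection onto `Q`. -/
def Detects {q n : ℕ} (Q : Submodule ℂ (QState q n))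
    (E : Matrix (Fin n → Fin q) (Fin n → Fin q) ℂ) : Prop :=
  ∃ c : ℂ, ∀ v ∈ Q, ∀ w ∈ Q, dotProduct (star v) (E.mulVec w) = c * dotProduct (star v) w

/-- `Q` is an `[[n, K, d]]_q` quantum code: a subspace of `(ℂ^q)^{⊗n}` of dimension `q^K` that
detects every error acting on fewer than `d` tensor factors. As usual, for `K = 0` (where every
error is detected by a one-dimensional space) the code is in addition required to be pure, i.e. the
scalar has to be the normalized trace of the error. -/
def IsQuantumCode {q n : ℕ} (K d : ℕ) (Q : Submodule ℂ (QState q n)) : Prop :=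
  Module.finrank ℂ Q = q ^ K ∧
  (∀ (S : Finset (Fin n)) (E : Matrix (Fin n → Fin q) (Fin n → Fin q) ℂ),
    S.card < d → ActsOn S E → Detects Q E) ∧
  (K = 0 → ∀ (S : Finset (Fin n)) (E : Matrix (Fin n → Fin q) (Fin n → Fin q) ℂ),
    S.card < d → ActsOn S E → ∀ v ∈ Q,
      dotProduct (star v) (E.mulVec v) = E.trace / (q : ℂ) ^ n * dotProduct (star v) v)

end

end SkewCode

open SkewCode

/-! The proof shows that each of the three component codes contains its Euclidean dual, transfers
this to the Gray image, and applies the CSS construction to the resulting code.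

Dual containment: for a block of length n > 0 with `Θ ^ n = 1`, the polynomial `xⁿ - 1` is central
and kills `Fⁿ`, on which `x` acts by the skew shift. As `F[x; Θ]` has no zero divisors, `h g = xⁿ -
1` implies `g h = xⁿ - 1`, and the kernel of `g` on words is the image of `h`. The reflection `v ↦
v*` turns orthogonality to `⟨g⟩` into `g v* = 0`, hence `v* = h b`. It also turns the dot product
into `twistedForm`, an additive form preserved by `x`, for which `h†` is the adjoint of `h` up to
the shift `x ^ deg h`. So for `v`, `w` in the dual, `v ⬝ w = ⟨h b, h b'⟩ = ⟨x ^ deg h b, h† h b'⟩`,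
which vanishes because `xⁿ - 1` right-divides `h† h`. The dual is thus self-orthogonal, so the code
contains it (`dualCode_le_of_rightDvd`). The relation `M Mᵀ = γ I` carries this over to the Gray
image (`dualCode_grayImage_le`).

Quantum code: let `D` be the Gray image and take the states supported on `D` and constant on cosets
of its dual; their dimension is `q ^ (2k - n)`, where n is now the full length. An error on fewer
than `d_H` places has no off-diagonal entries between words of `D`, and its diagonal is uncorrelated
with dual-invariant functions; so it acts on the code as its normalized trace (`cssCode_detects`).
Translation by a word of weight `d_H` shows sharpness (`not_isQuantumCode_cssCode`). -/

namespace SkewCode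

/-! ### Words as a module over the skew polynomial ring. -/

section SkewAction

open scoped Fin.CommRing

variable {F : Type*} [Field F] (Θ : RingAut F) (n : ℕ) [NeZero n]

/-- The powers of the skew cyclic shift, as additive endomorphisms of the space of words. -/
def shiftPow : Multiplicative ℕ →* AddMonoid.End (Fin n → F) where
  toFun k :=
    { toFun := fun c j => (Θ ^ k.toAdd : RingAut F) (c (j - (k.toAdd : Fin n)))
      map_zero' := by ext; simp
      map_add' := by intro c d; ext; simp }
  map_one' := by
    ext c j
    change (Θ ^ 0 : RingAut F) (c (j - ((0 : ℕ) : Fin n))) = c j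
    simp
  map_mul' k l := by
    ext c j
    change (Θ ^ (k.toAdd + l.toAdd) : RingAut F) (c (j - ((k.toAdd + l.toAdd : ℕ) : Fin n))) =
      (Θ ^ k.toAdd : RingAut F) ((Θ ^ l.toAdd : RingAut F)
        (c (j - (k.toAdd : Fin n) - (l.toAdd : Fin n))))
    rw [pow_add, Nat.cast_add, sub_sub]
    rfl

/-- The left action of skew polynomials on words, in which `x` acts by the skew cyclic shift. -/
noncomputable def skewAct : SkewPoly Θ →+* AddMonoid.End (Fin n → F) :=
  SkewMonoidAlgebra.liftNCRingHom
    ((Module.toAddMonoidEnd F (Fin n → F)).comp (toTwisted Θ).symm.toRingHom) (shiftPow Θ n) (by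
      -- This is the commutation rule `xᵏ a = Θᵏ(a) xᵏ`, read on words.
      intro a k
      ext c j
      exact (map_mul (Θ ^ k.toAdd : RingAut F) ((toTwisted Θ).symm a)
        (c (j - (k.toAdd : Fin n)))).symm)

variable {Θ n}

theorem skewAct_sub (p q : SkewPoly Θ) (c : Fin n → F) :
    skewAct Θ n (p - q) c = skewAct Θ n p c - skewAct Θ n q c := by
  rw [map_sub]
  rfl

theorem skewAct_mul (p q : SkewPoly Θ) (c : Fin n → F) :
    skewAct Θ n (p * q) c = skewAct Θ n p (skewAct Θ n q c) := by
  rw [map_mul]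
  rfl

theorem skewAct_one (c : Fin n → F) : skewAct Θ n 1 c = c := by
  rw [map_one]
  rfl

theorem skewAct_sum {ι : Type*} (s : Finset ι) (p : ι → SkewPoly Θ) (c : Fin n → F) :
    skewAct Θ n (∑ k ∈ s, p k) c = ∑ k ∈ s, skewAct Θ n (p k) c := by
  rw [map_sum]
  exact AddMonoidHom.finsetSum_apply _ _ _

theorem skewAct_monomial (k : ℕ) (a : F) (c : Fin n → F) (j : Fin n) :
    skewAct Θ n (SkewPolynomial.monomial k (toTwisted Θ a)) c j =
      a * (Θ ^ k : RingAut F) (c (j - (k : Fin n))) := by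
  have : skewAct Θ n (SkewPolynomial.monomial k (toTwisted Θ a)) = _ :=
    SkewMonoidAlgebra.liftNC_single _ _ _ _
  rw [this]
  rfl

theorem skewAct_X_pow (k : ℕ) (c : Fin n → F) (j : Fin n) :
    skewAct Θ n (SkewPolynomial.X ^ k) c j = (Θ ^ k : RingAut F) (c (j - (k : Fin n))) := by
  rw [← SkewPolynomial.monomial_one_right_eq_X_pow, ← map_one (toTwisted Θ), skewAct_monomial,
    one_mul]

theorem skewAct_xPowSubOne (hΘ : Θ ^ n = 1) : skewAct Θ n (xPowSubOne Θ n) = 0 := by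
  ext c j
  rw [xPowSubOne, skewAct_sub, skewAct_one, Pi.sub_apply, skewAct_X_pow, hΘ, Fin.natCast_self,
    sub_zero, RingAut.one_apply, sub_self]
  rfl

theorem skewAct_wordPoly_apply (c d : Fin n → F) (j : Fin n) :
    skewAct Θ n (wordPoly Θ c) d j = ∑ k : Fin n, c k * (Θ ^ (k : ℕ) : RingAut F) (d (j - k)) := by
  rw [wordPoly, skewAct_sum, Finset.sum_apply]
  simp [skewAct_monomial]

/-- The unit word at 0 generates the module of words; acting on it turns identities between
polynomials into identities between words. -/
theorem skewAct_wordPoly_single (c : Fin n → F) :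
    skewAct Θ n (wordPoly Θ c) (Pi.single 0 1) = c := by
  ext j
  rw [skewAct_wordPoly_apply, Finset.sum_eq_single j]
  · simp
  · intro k _ hk
    rw [Pi.single_eq_of_ne (sub_ne_zero.2 hk.symm), map_zero, mul_zero]
  · simp

end SkewAction

/-! ### Centrality of `xⁿ - 1` and absence of zero divisors. -/

section Cancellation

variable {F : Type*} [Field F] {Θ : RingAut F}

theorem monomial_toTwisted_mul (k l : ℕ) (a b : F) :
    (SkewPolynomial.monomial k (toTwisted Θ a) * SkewPolynomial.monomial l (toTwisted Θ b) :
      SkewPoly Θ) =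
      SkewPolynomial.monomial (k + l) (toTwisted Θ (a * (Θ ^ k : RingAut F) b)) := by
  rw [SkewPolynomial.monomial_mul_monomial, SkewPolynomial.φ_iterate_apply, twisted_smul_def,
    ← map_mul]

theorem skewPoly_induction {motive : SkewPoly Θ → Prop} (h : SkewPoly Θ)
    (zero : motive 0) (add : ∀ p q, motive p → motive q → motive (p + q))
    (monomial : ∀ k a, motive (SkewPolynomial.monomial k (toTwisted Θ a))) : motive h :=
  SkewPolynomial.induction h zero fun k r q _ _ hq =>
    add _ _ (by simpa using monomial k ((toTwisted Θ).symm r)) hq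

theorem xPowSubOne_commute {n : ℕ} (hΘ : Θ ^ n = 1) (p : SkewPoly Θ) :
    Commute (xPowSubOne Θ n) p := by
  induction p using skewPoly_induction with
  | zero => exact Commute.zero_right _
  | add p q hp hq => exact hp.add_right hq
  | monomial k a =>
    refine Commute.sub_left ?_ (Commute.one_left _)
    rw [← SkewPolynomial.monomial_one_right_eq_X_pow, ← map_one (toTwisted Θ)]
    rw [Commute, SemiconjBy, monomial_toTwisted_mul, monomial_toTwisted_mul, hΘ, add_comm]
    simp

theorem coeff_eq_zero_of_skewDegree_lt {p : SkewPoly Θ} {k : ℕ} (hk : skewDegree p < k) :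
    SkewPolynomial.coeff p k = 0 := by
  by_contra h
  exact hk.not_ge (Finset.le_sup (f := id) (SkewPolynomial.mem_support_iff.2 h))

theorem coeff_skewDegree_ne_zero {p : SkewPoly Θ} (hp : p ≠ 0) :
    SkewPolynomial.coeff p (skewDegree p) ≠ 0 := by
  have hne : (SkewPolynomial.support p).Nonempty :=
    Finset.nonempty_iff_ne_empty.2 (mt SkewPolynomial.support_eq_empty.1 hp)
  obtain ⟨k, hk, hk'⟩ := Finset.exists_mem_eq_sup _ hne id
  rw [skewDegree, hk']
  exact SkewPolynomial.mem_support_iff.1 hk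

theorem eq_sum_monomial (p : SkewPoly Θ) :
    p = ∑ k ∈ Finset.range (skewDegree p + 1),
      SkewPolynomial.monomial k (SkewPolynomial.coeff p k) := by
  conv_lhs => rw [← SkewPolynomial.sum_monomial p, SkewPolynomial.sum_def]
  refine Finset.sum_subset (fun k hk => ?_) (fun k _ hk => ?_)
  · exact Finset.mem_range_succ_iff.2 (Finset.le_sup (f := id) hk)
  · rw [SkewPolynomial.notMem_support_iff.1 hk, map_zero]

/-- Only the two leading terms reach the top degree. Since `Θ` is injective, their product is
nonzero, which excludes zero divisors. -/
theorem coeff_mul_skewDegree (p q : SkewPoly Θ) :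
    SkewPolynomial.coeff (p * q) (skewDegree p + skewDegree q) =
      SkewPolynomial.coeff p (skewDegree p) *
        Multiplicative.ofAdd (skewDegree p) • SkewPolynomial.coeff q (skewDegree q) := by
  have := SkewMonoidAlgebra.coeff_mul_antidiagonal_of_finset p q
    (Multiplicative.ofAdd (skewDegree p + skewDegree q))
    ((Finset.HasAntidiagonal.antidiagonal (skewDegree p + skewDegree q)).map
      (Multiplicative.ofAdd.prodCongr Multiplicative.ofAdd).toEmbedding) (by
        rintro ⟨a, b⟩
        induction a using Multiplicative.rec with | ofAdd a
        induction b using Multiplicative.rec with | ofAdd b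
        simp [← ofAdd_add])
  refine this.trans ?_
  rw [Finset.sum_map, Finset.sum_eq_single (skewDegree p, skewDegree q)]
  · rfl
  · rintro ⟨a, b⟩ hab hne
    have hab : a + b = skewDegree p + skewDegree q := Finset.HasAntidiagonal.mem_antidiagonal.1 hab
    change SkewPolynomial.coeff p a * Multiplicative.ofAdd a • SkewPolynomial.coeff q b = 0
    rcases lt_trichotomy a (skewDegree p) with h | h | h
    · rw [coeff_eq_zero_of_skewDegree_lt (p := q) (by omega), smul_zero, mul_zero]
    · exact absurd (Prod.ext h (by dsimp only; omega)) hne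
    · rw [coeff_eq_zero_of_skewDegree_lt h, zero_mul]
  · simp

instance : NoZeroDivisors (SkewPoly Θ) where
  eq_zero_or_eq_zero_of_mul_eq_zero {p q} h := by
    by_contra! hne
    have := coeff_mul_skewDegree p q
    rw [h, SkewPolynomial.coeff_zero] at this
    refine mul_ne_zero (coeff_skewDegree_ne_zero hne.1) ?_ this.symm
    intro h0
    rw [← (toTwisted Θ).apply_symm_apply (SkewPolynomial.coeff q (skewDegree q)),
      twisted_smul_def, map_eq_zero, map_eq_zero, map_eq_zero] at h0
    exact coeff_skewDegree_ne_zero hne.2 h0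

theorem xPowSubOne_ne_zero {n : ℕ} (hn : n ≠ 0) : xPowSubOne Θ n ≠ 0 := by
  intro h
  have := congrArg (fun p => SkewPolynomial.coeff p n) h
  simp only [xPowSubOne, SkewPolynomial.coeff_sub, SkewPolynomial.coeff_zero,
    ← SkewPolynomial.monomial_one_right_eq_X_pow, SkewPolynomial.coeff_monomial,
    SkewPolynomial.coeff_one, hn.symm] at this
  simp at this

end Cancellation

end SkewCode
namespace SkewCode

/-! ### Euclidean duality of linear codes. -/

section DualCode

variable {F : Type*} [Field F] {ι : Type*} [Fintype ι]

theorem dualCode_eq_orthogonal (D : Submodule F (ι → F)) :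
    dualCode D = LinearMap.BilinForm.orthogonal (dotProductBilin F F) D := by
  ext c
  refine forall₂_congr fun c' _ => ?_
  rw [dotProduct_comm]
  rfl

theorem dotProductBilin_isRefl :
    LinearMap.BilinForm.IsRefl (dotProductBilin F F : LinearMap.BilinForm F (ι → F)) := by
  intro c c' h
  exact (dotProduct_comm c' c).trans h

theorem dotProductBilin_nondegenerate :
    LinearMap.BilinForm.Nondegenerate (dotProductBilin F F : LinearMap.BilinForm F (ι → F)) := by
  refine ⟨fun c hc => dotProduct_eq_zero c hc, fun c hc => dotProduct_eq_zero c fun w => ?_⟩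
  rw [dotProduct_comm]
  exact hc w

theorem dualCode_dualCode (D : Submodule F (ι → F)) : dualCode (dualCode D) = D := by
  rw [dualCode_eq_orthogonal, dualCode_eq_orthogonal,
    LinearMap.BilinForm.orthogonal_orthogonal dotProductBilin_nondegenerate dotProductBilin_isRefl]

theorem finrank_add_finrank_dualCode (D : Submodule F (ι → F)) :
    Module.finrank F D + Module.finrank F (dualCode D) = Fintype.card ι := by
  have h := LinearMap.BilinForm.finrank_orthogonal
    (B := (dotProductBilin F F : LinearMap.BilinForm F (ι → F))) dotProductBilin_nondegenerate D
  rw [← dualCode_eq_orthogonal, Module.finrank_fintype_fun_eq_card] at h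
  have := Submodule.finrank_le D
  rw [Module.finrank_fintype_fun_eq_card] at this
  omega

end DualCode

/-! ### Dual containment for skew cyclic codes. -/

section SkewDual

open scoped Fin.CommRing

variable {F : Type*} [Field F] {Θ : RingAut F} {n : ℕ}

theorem isGeneratedBy_iff {D : Submodule F (Fin n → F)} {g : SkewPoly Θ} :
    IsGeneratedBy Θ D g ↔ ∀ c : Fin n → F, c ∈ D ↔
      ∃ a q : SkewPoly Θ, a * g - wordPoly Θ c = q * xPowSubOne Θ n := by
  refine forall_congr' fun c => iff_congr Iff.rfl ?_
  rw [Submodule.mem_span_singleton]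
  refine exists_congr fun a => ?_
  rw [← Submodule.Quotient.mk_smul, Submodule.Quotient.eq, Submodule.mem_span_singleton]
  exact exists_congr fun q => eq_comm

theorem pow_val_add (hΘ : Θ ^ n = 1) (i j : Fin n) :
    Θ ^ ((i + j : Fin n) : ℕ) = Θ ^ (i : ℕ) * Θ ^ (j : ℕ) := by
  rw [Fin.val_add, ← pow_eq_pow_mod _ hΘ, pow_add]

theorem wordPoly_add (c d : Fin n → F) : wordPoly Θ (c + d) = wordPoly Θ c + wordPoly Θ d := by
  simp [wordPoly, Finset.sum_add_distrib]

theorem wordPoly_single (j : Fin n) (a : F) :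
    wordPoly Θ (Pi.single j a) = SkewPolynomial.monomial (j : ℕ) (toTwisted Θ a) := by
  rw [wordPoly, Finset.sum_eq_single j]
  · simp
  · intro k _ hk
    simp [hk]
  · simp

theorem wordPoly_zero : wordPoly Θ (0 : Fin n → F) = 0 := by
  simp [wordPoly]

variable (Θ) in
/-- A form on words for which the skew cyclic shift is an isometry. -/
def twistedForm (c d : Fin n → F) : F :=
  ∑ j : Fin n, (Θ ^ (j : ℕ) : RingAut F)⁻¹ (c j * d j)

theorem twistedForm_sum_left {ι : Type*} (s : Finset ι) (c : ι → Fin n → F) (d : Fin n → F) :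
    twistedForm Θ (∑ k ∈ s, c k) d = ∑ k ∈ s, twistedForm Θ (c k) d := by
  simp only [twistedForm, Finset.sum_apply, Finset.sum_mul, map_sum]
  exact Finset.sum_comm

theorem twistedForm_sum_right {ι : Type*} (s : Finset ι) (c : Fin n → F) (d : ι → Fin n → F) :
    twistedForm Θ c (∑ k ∈ s, d k) = ∑ k ∈ s, twistedForm Θ c (d k) := by
  simp only [twistedForm, Finset.sum_apply, Finset.mul_sum, map_sum]
  exact Finset.sum_comm

variable [NeZero n]

theorem pow_val_natCast (hΘ : Θ ^ n = 1) (k : ℕ) : Θ ^ ((k : Fin n) : ℕ) = Θ ^ k := by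
  rw [Fin.val_natCast, ← pow_eq_pow_mod _ hΘ]

/-- Every skew polynomial is congruent modulo `xⁿ - 1` to the polynomial of a word. -/
theorem xPowSubOne_rightDvd_sub_wordPoly (p : SkewPoly Θ) :
    ∃ q, p - wordPoly Θ (skewAct Θ n p (Pi.single 0 1)) = q * xPowSubOne Θ n := by
  induction p using skewPoly_induction with
  | zero =>
    refine ⟨0, ?_⟩
    have : skewAct Θ n 0 (Pi.single 0 1) = 0 := by rw [map_zero]; rfl
    rw [this, wordPoly_zero, sub_zero, zero_mul]
  | add p q hp hq =>
    obtain ⟨a, ha⟩ := hp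
    obtain ⟨b, hb⟩ := hq
    refine ⟨a + b, ?_⟩
    have : skewAct Θ n (p + q) (Pi.single 0 1) =
        skewAct Θ n p (Pi.single 0 1) + skewAct Θ n q (Pi.single 0 1) := by rw [map_add]; rfl
    rw [this, wordPoly_add, add_mul, ← ha, ← hb]
    abel
  | monomial k a =>
    have : skewAct Θ n (SkewPolynomial.monomial k (toTwisted Θ a)) (Pi.single 0 1) =
        Pi.single (k : Fin n) a := by
      ext j
      rw [skewAct_monomial]
      by_cases h : j = (k : Fin n)
      · subst h
        simp
      · rw [Pi.single_eq_of_ne h, Pi.single_eq_of_ne (sub_ne_zero.2 h), map_zero, mul_zero]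
    rw [this, wordPoly_single, Fin.val_natCast]
    -- With `k = r + n s` and `r = k % n`, the difference is `a xʳ ((xⁿ)ˢ - 1)`, and the second
    -- factor is a geometric sum times `xⁿ - 1`.
    refine ⟨SkewPolynomial.monomial (k % n) (toTwisted Θ a) *
      ∑ i ∈ Finset.range (k / n), (SkewPolynomial.X ^ n) ^ i, ?_⟩
    rw [xPowSubOne, mul_assoc, geom_sum_mul, mul_sub, mul_one, ← pow_mul,
      SkewPolynomial.monomial_mul_X_pow, Nat.mod_add_div]

theorem skewAct_mul_xPowSubOne (hΘ : Θ ^ n = 1) (q : SkewPoly Θ) (c : Fin n → F) :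
    skewAct Θ n (q * xPowSubOne Θ n) c = 0 := by
  rw [skewAct_mul, skewAct_xPowSubOne hΘ]
  exact map_zero _

theorem skewAct_eq_of_sub_eq (hΘ : Θ ^ n = 1) {p r q : SkewPoly Θ}
    (h : p - r = q * xPowSubOne Θ n) : skewAct Θ n p = skewAct Θ n r := by
  ext1 c
  rw [← sub_eq_zero, ← skewAct_sub, h, skewAct_mul_xPowSubOne hΘ]

/-- The kernel of `g` acting on words is the image of `h` if `g h = xⁿ - 1`. -/
theorem exists_eq_skewAct_of_skewAct_eq_zero (hΘ : Θ ^ n = 1) {g h : SkewPoly Θ}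
    (hgh : xPowSubOne Θ n = g * h) {w : Fin n → F} (hw : skewAct Θ n g w = 0) :
    ∃ b, w = skewAct Θ n h b := by
  have hg : g ≠ 0 := by
    rintro rfl
    exact xPowSubOne_ne_zero (NeZero.ne n) (hgh.trans (zero_mul h))
  obtain ⟨q, hq⟩ := xPowSubOne_rightDvd_sub_wordPoly (n := n) (g * wordPoly Θ w)
  -- Here `g w = q (xⁿ - 1) = (xⁿ - 1) q = g h q`, so cancelling `g` gives `w = h q` as polynomials.
  rw [skewAct_mul, skewAct_wordPoly_single, hw, wordPoly_zero, sub_zero,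
    ← (xPowSubOne_commute hΘ q).eq, hgh, mul_assoc] at hq
  refine ⟨skewAct Θ n q (Pi.single 0 1), ?_⟩
  rw [← skewAct_mul, ← mul_left_cancel₀ hg hq, skewAct_wordPoly_single]

/-- Entry `j` moves to `j + k` and acquires `Θᵏ`, which the weight `Θ⁻⁽ʲ⁺ᵏ⁾` undoes; `Θ ^ n = 1`
covers the wrap-around. -/
theorem twistedForm_X_pow (hΘ : Θ ^ n = 1) (k : ℕ) (c d : Fin n → F) :
    twistedForm Θ (skewAct Θ n (SkewPolynomial.X ^ k) c) (skewAct Θ n (SkewPolynomial.X ^ k) d) =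
      twistedForm Θ c d := by
  rw [twistedForm, twistedForm, ← Equiv.sum_comp (Equiv.addRight (k : Fin n))]
  refine Finset.sum_congr rfl fun j _ => ?_
  rw [Equiv.coe_addRight, skewAct_X_pow, skewAct_X_pow, add_sub_cancel_right, ← map_mul,
    pow_val_add hΘ, pow_val_natCast hΘ, ← RingAut.mul_apply, mul_inv_rev,
    (Commute.refl Θ).pow_pow k j |>.inv_inv.eq, inv_mul_cancel_right]

theorem skewAct_eq_sum (h : SkewPoly Θ) (b : Fin n → F) :
    skewAct Θ n h b = ∑ k ∈ Finset.range (skewDegree h + 1),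
      (toTwisted Θ).symm (SkewPolynomial.coeff h k) • skewAct Θ n (SkewPolynomial.X ^ k) b := by
  conv_lhs => rw [eq_sum_monomial h, skewAct_sum]
  refine Finset.sum_congr rfl fun k _ => ?_
  ext j
  rw [Pi.smul_apply, skewAct_X_pow, smul_eq_mul, ← skewAct_monomial, RingEquiv.apply_symm_apply]

theorem skewAct_dagger_eq_sum (h : SkewPoly Θ) (b : Fin n → F) :
    skewAct Θ n (dagger h) b = ∑ k ∈ Finset.range (skewDegree h + 1),
      skewAct Θ n (SkewPolynomial.X ^ k)
        ((toTwisted Θ).symm (SkewPolynomial.coeff h (skewDegree h - k)) • b) := by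
  rw [dagger, skewAct_sum]
  refine Finset.sum_congr rfl fun k _ => ?_
  ext j
  rw [skewAct_monomial, skewAct_X_pow, Pi.smul_apply, smul_eq_mul, map_mul]

/-- Up to a shift, `h†` is the adjoint of `h`. -/
theorem twistedForm_skewAct_left (hΘ : Θ ^ n = 1) (h : SkewPoly Θ) (b c : Fin n → F) :
    twistedForm Θ (skewAct Θ n h b) c =
      twistedForm Θ (skewAct Θ n (SkewPolynomial.X ^ skewDegree h) b)
        (skewAct Θ n (dagger h) c) := by
  rw [skewAct_eq_sum, skewAct_dagger_eq_sum, twistedForm_sum_left, twistedForm_sum_right,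
    ← Finset.sum_range_reflect]
  refine Finset.sum_congr rfl fun k hk => ?_
  have hk : k ≤ skewDegree h := Finset.mem_range_succ_iff.1 hk
  have hd : skewDegree h + 1 - 1 - k = skewDegree h - k := by omega
  -- The isometry `xᵏ` is cancelled from both arguments; the remaining coefficient moves across
  -- because the form depends only on the entrywise product.
  conv_rhs => rw [show skewDegree h = k + (skewDegree h - k) by omega, pow_add, skewAct_mul,
    twistedForm_X_pow hΘ]
  rw [hd, Nat.add_sub_cancel_left]
  refine Finset.sum_congr rfl fun j _ => ?_
  simp only [Pi.smul_apply, smul_eq_mul]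
  congr 1
  ring

variable (Θ) in
/-- The reflection of a word, i.e. its image under `a xʲ ↦ x⁻ʲ a`. -/
def reflect (v : Fin n → F) : Fin n → F :=
  fun j => (Θ ^ ((-j : Fin n) : ℕ) : RingAut F)⁻¹ (v (-j))

/-- The reflection is chosen so that the dot product becomes a constant coefficient, where the
module structure can be used. -/
theorem skewAct_wordPoly_reflect (c v : Fin n → F) :
    skewAct Θ n (wordPoly Θ c) (reflect Θ v) 0 = dotProduct v c := by
  rw [skewAct_wordPoly_apply]
  refine Finset.sum_congr rfl fun k _ => ?_
  rw [reflect, zero_sub, neg_neg, ← RingAut.mul_apply, mul_inv_cancel, RingAut.one_apply, mul_comm]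

theorem twistedForm_reflect (hΘ : Θ ^ n = 1) (v w : Fin n → F) :
    twistedForm Θ (reflect Θ v) (reflect Θ w) = dotProduct v w := by
  rw [twistedForm, dotProduct, ← Equiv.sum_comp (Equiv.neg (Fin n))]
  refine Finset.sum_congr rfl fun k _ => ?_
  rw [Equiv.neg_apply, reflect, reflect, neg_neg, ← map_mul, ← RingAut.mul_apply, ← mul_inv_rev,
    ← pow_val_add hΘ, add_neg_cancel]
  simp

/-- A code `⟨g⟩` with `h g = xⁿ - 1` contains its Euclidean dual if `xⁿ - 1` divides `h† h`. -/
theorem dualCode_le_of_rightDvd_of_neZero (hΘ : Θ ^ n = 1) {D : Submodule F (Fin n → F)}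
    {g h : SkewPoly Θ} (hD : IsGeneratedBy Θ D g) (hhg : xPowSubOne Θ n = h * g)
    (hdiv : xPowSubOne Θ n ∣ᵣ dagger h * h) : dualCode D ≤ D := by
  have hh : h ≠ 0 := by
    rintro rfl
    exact xPowSubOne_ne_zero (NeZero.ne n) (hhg.trans (zero_mul g))
  -- By centrality `h (g h) = (xⁿ - 1) h = h (xⁿ - 1)`; cancel `h`.
  have hgh : xPowSubOne Θ n = g * h := by
    refine mul_left_cancel₀ hh ?_
    rw [← mul_assoc, ← hhg, (xPowSubOne_commute hΘ h).eq]
  rw [isGeneratedBy_iff] at hD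
  have key : ∀ v ∈ dualCode D, ∃ b, reflect Θ v = skewAct Θ n h b := by
    intro v hv
    refine exists_eq_skewAct_of_skewAct_eq_zero hΘ hgh ?_
    -- Orthogonality to every shift of `g` kills the constant coefficient of every `xᵏ g v*`, and
    -- these are, up to powers of `Θ`, all the coefficients of `g v*`.
    have hz : ∀ k : ℕ, skewAct Θ n (SkewPolynomial.X ^ k * g) (reflect Θ v) 0 = 0 := by
      intro k
      obtain ⟨q, hq⟩ := xPowSubOne_rightDvd_sub_wordPoly (n := n) (SkewPolynomial.X ^ k * g)
      rw [skewAct_eq_of_sub_eq hΘ hq, skewAct_wordPoly_reflect]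
      exact hv _ ((hD _).2 ⟨_, q, hq⟩)
    ext j
    have := hz ((-j : Fin n) : ℕ)
    rw [skewAct_mul, skewAct_X_pow, map_eq_zero] at this
    simpa using this
  obtain ⟨t, ht⟩ := hdiv
  intro v hv
  -- It suffices that any two words of the dual are orthogonal.
  rw [← dualCode_dualCode D]
  intro w hw
  obtain ⟨b, hb⟩ := key v hv
  obtain ⟨b', hb'⟩ := key w hw
  rw [← twistedForm_reflect hΘ, hb, hb', twistedForm_skewAct_left hΘ, ← skewAct_mul, ht,
    skewAct_mul_xPowSubOne hΘ]
  simp [twistedForm]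

theorem dualCode_le_of_rightDvd {n : ℕ} (hΘ : Θ ^ n = 1) {D : Submodule F (Fin n → F)}
    {g h : SkewPoly Θ} (hD : IsGeneratedBy Θ D g) (hhg : xPowSubOne Θ n = h * g)
    (hdiv : xPowSubOne Θ n ∣ᵣ dagger h * h) : dualCode D ≤ D := by
  rcases Nat.eq_zero_or_pos n with rfl | hn
  · intro v _
    rw [Subsingleton.elim v 0]
    exact D.zero_mem
  · have : NeZero n := ⟨hn.ne'⟩
    exact dualCode_le_of_rightDvd_of_neZero hΘ hD hhg hdiv

end SkewDual

/-! ### From the component codes to the Gray image. -/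

section Gray

variable {F : Type*} [Field F] {α β : ℕ}

theorem pow_eq_one_of_orderOf_thetaAut_dvd {Θ : RingAut F} {n : ℕ}
    (h : orderOf (thetaAut Θ) ∣ n) : Θ ^ n = 1 := by
  have hpow : ∀ k : ℕ, ∀ a : F,
      (thetaAut Θ ^ k : RingAut (MixedRing F)) ⟨a, 0⟩ = ⟨(Θ ^ k : RingAut F) a, 0⟩ := by
    intro k
    induction k with
    | zero => intro a; rfl
    | succ k ih =>
      intro a
      rw [pow_succ, pow_succ, RingAut.mul_apply, RingAut.mul_apply, ← ih]
      congr 1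
      change (⟨Θ a, Θ 0⟩ : MixedRing F) = _
      rw [map_zero]
  ext a
  have := hpow n a
  rw [orderOf_dvd_iff_pow_eq_one.1 h] at this
  exact (congrArg QuadraticAlgebra.re this).symm

theorem mem_of_mem_componentOne_of_mem_componentTwo {n : ℕ}
    {D : Submodule (MixedRing F) (Fin n → MixedRing F)} {a b : Fin n → F}
    (ha : a ∈ componentOne D) (hb : b ∈ componentTwo D) :
    (fun j => (⟨a j, b j - a j⟩ : MixedRing F)) ∈ D := by
  obtain ⟨r, hr, rfl⟩ := ha
  obtain ⟨s, hs, rfl⟩ := hb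
  -- The two scalars are the orthogonal idempotents `ξ₁ = 1 - u` and `ξ₂ = u`.
  have : (fun j => (⟨(r j).re, ((s j).re + (s j).im) - (r j).re⟩ : MixedRing F)) =
      (⟨1, -1⟩ : MixedRing F) • r + (⟨0, 1⟩ : MixedRing F) • s := by
    ext j
    · simp
    · simp
      ring
  rw [this]
  exact D.add_mem (D.smul_mem _ hr) (D.smul_mem _ hs)

/-- The Gray image of a separable code contains its Euclidean dual if the three component codes
contain theirs. -/
theorem dualCode_grayImage_le {M : Matrix (Fin 2) (Fin 2) F} {γ : F} (hγ : γ ≠ 0)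
    (hM : M * M.transpose = γ • (1 : Matrix (Fin 2) (Fin 2) F))
    {C : Submodule (MixedRing F) (MixedSpace F α β)} {C' : Submodule F (Fin α → F)}
    {D : Submodule (MixedRing F) (Fin β → MixedRing F)}
    (hsep : ∀ (x : Fin α → F) (y : Fin β → MixedRing F), (x, y) ∈ C ↔ x ∈ C' ∧ y ∈ D)
    (h' : dualCode C' ≤ C') (h₁ : dualCode (componentOne D) ≤ componentOne D)
    (h₂ : dualCode (componentTwo D) ≤ componentTwo D) :
    dualCode (grayImage M C) ≤ grayImage M C := by
  intro w hw
  have hM' : M.transpose * M = γ • (1 : Matrix (Fin 2) (Fin 2) F) := by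
    have h1 : M * (γ⁻¹ • M.transpose) = 1 := by
      rw [Matrix.mul_smul, hM, smul_smul, inv_mul_cancel₀ hγ, one_smul]
    have h2 := mul_eq_one_comm.1 h1
    rw [Matrix.smul_mul] at h2
    rw [← h2, smul_smul, mul_inv_cancel₀ hγ, one_smul]
  -- Since `w ⬝ (r M) = (M w) ⬝ r`, orthogonality of `w` to the Gray image is orthogonality of `s`
  -- to the component codes; `Mᵀ M = γ I` recovers `w` as `(γ⁻¹ s) M`.
  set s : Fin β → Fin 2 → F := fun j => M.mulVec fun l => w (Sum.inr (j, l)) with hs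
  have hdot : ∀ c ∈ C, (∑ i, w (Sum.inl i) * c.1 i) +
      ∑ j, (s j 0 * (c.2 j).re + s j 1 * ((c.2 j).re + (c.2 j).im)) = 0 := by
    intro c hc
    refine Eq.trans ?_ (hw (grayMap M α β c) ⟨c, hc, rfl⟩)
    rw [dotProduct, Fintype.sum_sum_type,
      Fintype.sum_prod_type]
    refine congrArg₂ (· + ·) rfl (Finset.sum_congr rfl fun j _ => ?_)
    simp [hs, grayMap, Matrix.vecMul, dotProduct, Fin.sum_univ_two]
    ring
  have hx : (fun i => w (Sum.inl i)) ∈ C' := by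
    refine h' fun x hx => ?_
    simpa [dotProduct] using hdot (x, 0) ((hsep _ _).2 ⟨hx, D.zero_mem⟩)
  have hs₁ : (fun j => γ⁻¹ * s j 0) ∈ componentOne D := by
    refine (componentOne D).smul_mem γ⁻¹ (h₁ ?_)
    rintro _ ⟨r, hr, rfl⟩
    have := hdot (0, (⟨1, -1⟩ : MixedRing F) • r)
      ((hsep _ _).2 ⟨C'.zero_mem, D.smul_mem _ hr⟩)
    simpa [dotProduct] using this
  have hs₂ : (fun j => γ⁻¹ * s j 1) ∈ componentTwo D := by
    refine (componentTwo D).smul_mem γ⁻¹ (h₂ ?_)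
    rintro _ ⟨r, hr, rfl⟩
    have := hdot (0, (⟨0, 1⟩ : MixedRing F) • r)
      ((hsep _ _).2 ⟨C'.zero_mem, D.smul_mem _ hr⟩)
    simpa [dotProduct] using this
  refine ⟨_, (hsep _ _).2 ⟨hx, mem_of_mem_componentOne_of_mem_componentTwo hs₁ hs₂⟩, ?_⟩
  ext (i | ⟨j, l⟩)
  · rfl
  · have : w (Sum.inr (j, l)) =
        γ⁻¹ * ((M.transpose * M).mulVec fun l => w (Sum.inr (j, l))) l := by
      rw [hM', Matrix.smul_mulVec, Matrix.one_mulVec, Pi.smul_apply, smul_eq_mul,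
        inv_mul_cancel_left₀ hγ]
    rw [this, ← Matrix.mulVec_mulVec]
    change Matrix.vecMul ![γ⁻¹ * s j 0, γ⁻¹ * s j 0 + (γ⁻¹ * s j 1 - γ⁻¹ * s j 0)] M l =
      γ⁻¹ * (M.transpose.mulVec (s j)) l
    simp [Matrix.vecMul, Matrix.mulVec, dotProduct, Fin.sum_univ_two]
    ring

end Gray

end SkewCode
namespace SkewCode

/-! ### The CSS construction and its distance. -/

section CSS

variable {F : Type*} [Field F] {ι : Type*} [Fintype ι]

/-- If no nonzero word of `D` is supported on `T`, then the words of the dual code take arbitrary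
values on `T`. -/
theorem exists_mem_dualCode_eqOn {D : Submodule F (ι → F)} {T : Finset ι}
    (hT : ∀ c ∈ D, (∀ i, i ∉ T → c i = 0) → c = 0) (y : ι → F) :
    ∃ z ∈ dualCode D, ∀ i ∈ T, z i = y i := by
  classical
  let K : Submodule F (ι → F) :=
    { carrier := {z | ∀ i ∈ T, z i = 0}
      zero_mem' := fun _ _ => rfl
      add_mem' := fun {a b} ha hb i hi => by simp [ha i hi, hb i hi]
      smul_mem' := fun t a ha i hi => by simp [ha i hi] }
  -- The dual of the sum consists of the words of `D` supported on `T`.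
  have htop : dualCode (dualCode D ⊔ K) = ⊥ := by
    refine (Submodule.eq_bot_iff _).2 fun c hc => hT c ?_ fun i hi => ?_
    · rw [← dualCode_dualCode D]
      exact fun c' hc' => hc c' (Submodule.mem_sup_left hc')
    · have hmem : (Pi.single i 1 : ι → F) ∈ K :=
        fun j hj => Pi.single_eq_of_ne (ne_of_mem_of_not_mem hj hi) _
      simpa using hc _ (Submodule.mem_sup_right hmem)
  have hy : y ∈ dualCode D ⊔ K := by
    rw [← dualCode_dualCode (dualCode D ⊔ K), htop]
    intro c hc
    rw [(Submodule.mem_bot F).1 hc, dotProduct_zero]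
  obtain ⟨z, hz, z', hz', rfl⟩ := Submodule.mem_sup.1 hy
  exact ⟨z, hz, fun i hi => by rw [Pi.add_apply, hz' i hi, add_zero]⟩

/-- On `T` any translation agrees with one by a dual word, which `f` does not see. So `∑ f(x) b(x +
y)` does not depend on `y`, and summing over `y` separates the factors. -/
theorem card_mul_sum_mul_eq [Fintype (ι → F)] {D : Submodule F (ι → F)} {T : Finset ι}
    (hT : ∀ c ∈ D, (∀ i, i ∉ T → c i = 0) → c = 0) {f b : (ι → F) → ℂ}
    (hf : ∀ x, ∀ z ∈ dualCode D, f (x + z) = f x)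
    (hb : ∀ x y, (∀ i ∈ T, x i = y i) → b x = b y) :
    (Fintype.card (ι → F) : ℂ) * ∑ x, f x * b x = (∑ x, f x) * ∑ y, b y := by
  have htrans : ∀ y, ∑ x, f x * b (x + y) = ∑ x, f x * b x := by
    intro y
    obtain ⟨z, hz, hzy⟩ := exists_mem_dualCode_eqOn hT y
    rw [← Equiv.sum_comp (Equiv.addRight z) fun x => f x * b x]
    refine Finset.sum_congr rfl fun x _ => ?_
    rw [Equiv.coe_addRight, hf x z hz, hb (x + y) (x + z)]
    intro i hi
    rw [Pi.add_apply, Pi.add_apply, hzy i hi]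
  calc (Fintype.card (ι → F) : ℂ) * ∑ x, f x * b x
      = ∑ y : ι → F, ∑ x, f x * b (x + y) := by simp [htrans]
    _ = ∑ x, ∑ y, f x * b (x + y) := Finset.sum_comm
    _ = (∑ x, f x) * ∑ y, b y := by
        rw [Finset.sum_mul]
        refine Finset.sum_congr rfl fun x _ => ?_
        rw [← Finset.mul_sum]
        exact congrArg (f x * ·) (Equiv.sum_comp (Equiv.addLeft x) b)

variable {q n : ℕ} (e : F ≃ Fin q) (ε : Fin n ≃ ι)

/-- The labelling of basis states by words over `F`. -/
def decodeWord : (Fin n → Fin q) ≃ (ι → F) := Equiv.arrowCongr ε e.symm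

theorem decodeWord_apply {F ι : Type*} {q n : ℕ} (e : F ≃ Fin q) (ε : Fin n ≃ ι)
    (x : Fin n → Fin q) (i : Fin n) :
    decodeWord e ε x (ε i) = e.symm (x i) := by
  simp [decodeWord]

/-- The quantum code spanned by the sums of the basis states over the cosets of the dual code
in `D`. -/
def cssCode (D : Submodule F (ι → F)) : Submodule ℂ (QState q n) where
  carrier := {v | (∀ x, decodeWord e ε x ∉ D → v x = 0) ∧
    ∀ x y, decodeWord e ε x - decodeWord e ε y ∈ dualCode D → v x = v y}
  zero_mem' := ⟨fun _ _ => rfl, fun _ _ _ => rfl⟩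
  add_mem' := fun {v w} hv hw =>
    ⟨fun x hx => by simp [hv.1 x hx, hw.1 x hx],
      fun x y h => by simp [hv.2 x y h, hw.2 x y h]⟩
  smul_mem' := fun t v hv =>
    ⟨fun x hx => by simp [hv.1 x hx], fun x y h => by simp [hv.2 x y h]⟩

open scoped Classical in
/-- Functions on `D / Dᗮ` as states of `cssCode D`. -/
noncomputable def cssCodeEquiv {D : Submodule F (ι → F)} (hD : dualCode D ≤ D) :
    ((D ⧸ (dualCode D).comap D.subtype) → ℂ) ≃ₗ[ℂ] cssCode e ε D where
  toFun f := ⟨fun x => if h : decodeWord e ε x ∈ D then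
      f (Submodule.Quotient.mk ⟨decodeWord e ε x, h⟩) else 0, by
    refine ⟨fun x hx => dif_neg hx, fun x y h => ?_⟩
    by_cases hx : decodeWord e ε x ∈ D
    · have hy : decodeWord e ε y ∈ D := by
        simpa using D.sub_mem hx (hD h)
      refine (dif_pos hx).trans (Eq.trans ?_ (dif_pos hy).symm)
      congr 1
      exact (Submodule.Quotient.eq _).2 h
    · have hy : decodeWord e ε y ∉ D := fun hy => hx (by simpa using D.add_mem (hD h) hy)
      refine Eq.trans (b := (0 : ℂ)) (dif_neg hx) (Eq.symm ?_)
      exact dif_neg hy⟩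
  map_add' f g := by
    ext x
    by_cases hx : decodeWord e ε x ∈ D <;> simp [hx]
  map_smul' t f := by
    ext x
    by_cases hx : decodeWord e ε x ∈ D <;> simp [hx]
  invFun v t := v.1 ((decodeWord e ε).symm (Quotient.out t : D))
  left_inv f := by
    ext t
    dsimp only
    rw [dif_pos (by rw [Equiv.apply_symm_apply]; exact (Quotient.out t : D).2)]
    congr 1
    simp only [Equiv.apply_symm_apply]
    exact Quotient.out_eq t
  right_inv v := by
    ext x
    dsimp only
    by_cases hx : decodeWord e ε x ∈ D
    · rw [dif_pos hx]
      refine v.2.2 _ _ ?_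
      rw [Equiv.apply_symm_apply]
      exact (Submodule.Quotient.eq ((dualCode D).comap D.subtype)).1
        (Quotient.out_eq (Submodule.Quotient.mk ⟨decodeWord e ε x, hx⟩ :
          D ⧸ (dualCode D).comap D.subtype))
    · rw [dif_neg hx, v.2.1 x hx]

/-- The dimension counts the cosets of the dual in `D`, and `dim D - dim Dᗮ = 2 dim D - n`. -/
theorem finrank_cssCode {D : Submodule F (ι → F)} (hD : dualCode D ≤ D) :
    Module.finrank ℂ (cssCode e ε D) = q ^ (2 * Module.finrank F D - n) := by
  have : Fintype F := Fintype.ofEquiv _ e.symm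
  have : Finite (D ⧸ (dualCode D).comap D.subtype) := Module.finite_of_finite F
  have : Fintype (D ⧸ (dualCode D).comap D.subtype) := Fintype.ofFinite _
  have hq : Fintype.card F = q := by rw [Fintype.card_congr e, Fintype.card_fin]
  have hn : Fintype.card ι = n := by rw [← Fintype.card_congr ε, Fintype.card_fin]
  rw [← (cssCodeEquiv e ε hD).finrank_eq, Module.finrank_fintype_fun_eq_card,
    Module.card_eq_pow_finrank (K := F), hq]
  congr 1
  have h₁ := Submodule.finrank_quotient_add_finrank ((dualCode D).comap D.subtype)
  rw [(Submodule.comapSubtypeEquivOfLe hD).finrank_eq] at h₁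
  have h₂ := finrank_add_finrank_dualCode D
  omega

open scoped Classical in
/-- The (unnormalized) state of the coset of `c`. -/
noncomputable def cosetState (D : Submodule F (ι → F)) (c : ι → F) : QState q n :=
  fun x => if decodeWord e ε x - c ∈ dualCode D then 1 else 0

open scoped Classical in
theorem cosetState_mem {D : Submodule F (ι → F)} (hD : dualCode D ≤ D) {c : ι → F} (hc : c ∈ D) :
    cosetState e ε D c ∈ cssCode e ε D := by
  refine ⟨fun x hx => if_neg fun h => hx ?_, fun x y h => ?_⟩
  · simpa using D.add_mem (hD h) hc
  · refine if_congr ?_ rfl rfl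
    rw [← sub_add_sub_cancel _ (decodeWord e ε y), Submodule.add_mem_iff_right _ h]

variable [DecidableEq F]

theorem hammingNorm_le_card {c : ι → F} {T : Finset ι} (h : ∀ i, i ∉ T → c i = 0) :
    hammingNorm c ≤ T.card := by
  refine Finset.card_le_card fun i hi => ?_
  by_contra hiT
  exact (Finset.mem_filter.1 hi).2 (h i hiT)

/-- `cssCode D` purely detects the errors on fewer than `d` tensor factors if the nonzero words
of `D` have weight at least `d`. -/
theorem cssCode_detects {D : Submodule F (ι → F)} {d : ℕ}
    (hd : ∀ c ∈ D, c ≠ 0 → d ≤ hammingNorm c) {S : Finset (Fin n)}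
    {E : Matrix (Fin n → Fin q) (Fin n → Fin q) ℂ} (hS : S.card < d) (hE : ActsOn S E)
    {v w : QState q n} (hv : v ∈ cssCode e ε D) (hw : w ∈ cssCode e ε D) :
    dotProduct (star v) (E.mulVec w) = E.trace / (q : ℂ) ^ n * dotProduct (star v) w := by
  obtain ⟨A, hA⟩ := hE
  have : Fintype F := Fintype.ofEquiv _ e.symm
  have : Fintype (ι → F) := Fintype.ofEquiv _ (decodeWord e ε)
  have hT : ∀ c ∈ D, (∀ i, i ∉ S.map ε.toEmbedding → c i = 0) → c = 0 := by
    intro c hc h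
    by_contra hne
    have := (hd c hc hne).trans (hammingNorm_le_card h)
    rw [Finset.card_map] at this
    omega
  -- A nonzero entry of `E` between distinct words of `D` would make their difference a nonzero word
  -- of `D` supported on `S`.
  have hdiag : dotProduct (star v) (E.mulVec w) = ∑ x, star (v x) * w x * E x x := by
    refine Finset.sum_congr rfl fun x _ => ?_
    rw [Pi.star_apply, mul_assoc, mul_comm (w x)]
    by_cases hx : decodeWord e ε x ∈ D
    · congr 1
      refine Finset.sum_eq_single x (fun y _ hyx => ?_) (by simp)
      by_cases hy : decodeWord e ε y ∈ D
      · refine mul_eq_zero_of_left ((hA x y).2 ?_) _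
        by_contra! hxy
        refine hyx ((decodeWord e ε).injective ?_).symm
        refine sub_eq_zero.1 (hT _ (D.sub_mem hx hy) fun i hi => ?_)
        obtain ⟨i, rfl⟩ := ε.surjective i
        rw [Pi.sub_apply, decodeWord_apply, decodeWord_apply, hxy i, sub_self]
        exact fun h => hi (Finset.mem_map_of_mem _ h)
      · rw [hw.1 y hy, mul_zero]
    · rw [hv.1 x hx, star_zero, zero_mul, zero_mul]
  have hsum := card_mul_sum_mul_eq (D := D) hT
    (f := fun x => star (v ((decodeWord e ε).symm x)) * w ((decodeWord e ε).symm x))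
    (b := fun x => E ((decodeWord e ε).symm x) ((decodeWord e ε).symm x)) (by
      intro x z hz
      rw [hv.2 ((decodeWord e ε).symm (x + z)) ((decodeWord e ε).symm x) (by simpa using hz),
        hw.2 ((decodeWord e ε).symm (x + z)) ((decodeWord e ε).symm x) (by simpa using hz)]) (by
      intro x y hxy
      refine ((hA _ _).1 fun _ _ => rfl).trans (Eq.trans ?_ ((hA _ _).1 fun _ _ => rfl).symm)
      have : ∀ i : S, (decodeWord e ε).symm x i = (decodeWord e ε).symm y i := by
        intro i
        refine e.symm.injective ?_
        rw [← decodeWord_apply e ε, ← decodeWord_apply e ε, Equiv.apply_symm_apply,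
          Equiv.apply_symm_apply]
        exact hxy _ (Finset.mem_map_of_mem _ i.2)
      simp only [this])
  rw [Equiv.sum_comp (decodeWord e ε).symm fun x => star (v x) * w x * E x x,
    Equiv.sum_comp (decodeWord e ε).symm fun x => star (v x) * w x,
    Equiv.sum_comp (decodeWord e ε).symm fun x => E x x, ← hdiag,
    ← Fintype.card_congr (decodeWord e ε), Fintype.card_fun, Fintype.card_fin, Fintype.card_fin,
    Nat.cast_pow] at hsum
  have hq : (q : ℂ) ^ n ≠ 0 := by
    exact pow_ne_zero _ (Nat.cast_ne_zero.2 (e 0).pos.ne')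
  rw [div_mul_eq_mul_div, eq_div_iff hq, mul_comm, hsum, mul_comm]
  rfl

theorem isQuantumCode_cssCode {D : Submodule F (ι → F)} (hD : dualCode D ≤ D) {d : ℕ}
    (hd : ∀ c ∈ D, c ≠ 0 → d ≤ hammingNorm c) :
    IsQuantumCode (2 * Module.finrank F D - n) d (cssCode e ε D) :=
  ⟨finrank_cssCode e ε hD,
    fun _ _ hS hE => ⟨_, fun _ hv _ hw => cssCode_detects e ε hd hS hE hv hw⟩,
    fun _ _ _ hS hE _ hv => cssCode_detects e ε hd hS hE hv hv⟩

/-- The operator which maps the basis state of a word `y` to that of `y + c`. -/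
def shiftError (c : ι → F) : Matrix (Fin n → Fin q) (Fin n → Fin q) ℂ :=
  fun x y => if decodeWord e ε x = decodeWord e ε y + c then 1 else 0

theorem shiftError_actsOn (c : ι → F) :
    ActsOn (Finset.univ.filter fun i => c (ε i) ≠ 0) (shiftError e ε c) := by
  refine ⟨fun s t => if ∀ i, e.symm (s i) = e.symm (t i) + c (ε i) then 1 else 0,
    fun x y => ⟨?_, ?_⟩⟩
  · intro h
    refine if_congr ?_ rfl rfl
    rw [funext_iff, ← ε.forall_congr_right]
    simp only [Pi.add_apply, decodeWord_apply]
    refine ⟨fun hx i => hx i, fun hx i => ?_⟩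
    by_cases hi : c (ε i) = 0
    · rw [h i (by simpa using hi), hi, add_zero]
    · exact hx ⟨i, by simpa using hi⟩
  · rintro ⟨i, hi, hxy⟩
    refine if_neg fun h => hxy (e.symm.injective ?_)
    have := congrFun h (ε i)
    rw [Pi.add_apply, decodeWord_apply, decodeWord_apply] at this
    rw [this, show c (ε i) = 0 by simpa using hi, add_zero]

theorem card_filter_ne_zero (c : ι → F) :
    (Finset.univ.filter fun i => c (ε i) ≠ 0).card = hammingNorm c := by
  rw [hammingNorm, ← Finset.card_map ε.toEmbedding]
  congr 1
  ext i
  obtain ⟨i, rfl⟩ := ε.surjective i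
  simp

theorem shiftError_mulVec (c : ι → F) (w : QState q n) (x : Fin n → Fin q) :
    (shiftError e ε c).mulVec w x = w ((decodeWord e ε).symm (decodeWord e ε x - c)) := by
  refine (Finset.sum_eq_single ((decodeWord e ε).symm (decodeWord e ε x - c)) ?_ (by simp)).trans ?_
  · intro y _ hy
    refine mul_eq_zero_of_left (if_neg fun h => hy ?_) _
    rw [h, add_sub_cancel_right, Equiv.symm_apply_apply]
  · exact (congrArg (· * _) (if_pos (by simp))).trans (one_mul _)

theorem trace_shiftError {c : ι → F} (hc : c ≠ 0) : (shiftError e ε c).trace = 0 := by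
  refine Finset.sum_eq_zero fun x _ => if_neg ?_
  simpa using hc

/-- The shift carries the state of the dual code to that of its coset by `c`, so the product is the
size of that coset. -/
theorem star_cosetState_dotProduct_shiftError_ne_zero (D : Submodule F (ι → F)) (c : ι → F) :
    dotProduct (star (cosetState e ε D c)) ((shiftError e ε c).mulVec (cosetState e ε D 0)) ≠ 0 := by
  classical
  have : dotProduct (star (cosetState e ε D c))
      ((shiftError e ε c).mulVec (cosetState e ε D 0)) =
      ((Finset.univ.filter fun x => decodeWord e ε x - c ∈ dualCode D).card : ℂ) := by
    rw [Finset.card_filter, Nat.cast_sum]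
    refine Finset.sum_congr rfl fun x _ => ?_
    rw [shiftError_mulVec]
    by_cases h : decodeWord e ε x - c ∈ dualCode D <;> simp [cosetState, h]
  rw [this, Nat.cast_ne_zero, ← Nat.pos_iff_ne_zero, Finset.card_pos]
  exact ⟨(decodeWord e ε).symm c, by simp⟩

open scoped Classical in
-- The shift by `c` is the undetected error. If `c` is outside the dual, it connects two orthogonal
-- code states. If `D` is self-dual, it fixes the code state of the dual although its trace is zero,
-- contradicting purity.
theorem not_isQuantumCode_cssCode {D : Submodule F (ι → F)} (hD : dualCode D ≤ D) {c : ι → F}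
    (hc : c ∈ D) (hc₀ : c ≠ 0) (h : c ∉ dualCode D ∨ D = dualCode D) :
    ¬ IsQuantumCode (2 * Module.finrank F D - n) (hammingNorm c + 1) (cssCode e ε D) := by
  rintro ⟨-, hdet, hpure⟩
  have hcard : (Finset.univ.filter fun i => c (ε i) ≠ 0).card < hammingNorm c + 1 := by
    rw [card_filter_ne_zero]
    exact Nat.lt_succ_self _
  have hne := star_cosetState_dotProduct_shiftError_ne_zero e ε D c
  by_cases hcD : c ∈ dualCode D
  · have hself := h.resolve_left (not_not.2 hcD)
    have hK : 2 * Module.finrank F D - n = 0 := by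
      have h₂ := finrank_add_finrank_dualCode D
      rw [← hself, ← Fintype.card_congr ε, Fintype.card_fin] at h₂
      omega
    have hstate : (cosetState e ε D c : QState q n) = cosetState e ε D 0 := by
      ext x
      refine if_congr ?_ rfl rfl
      rw [sub_zero, sub_eq_add_neg, Submodule.add_mem_iff_left _ (Submodule.neg_mem _ hcD)]
    have := hpure hK _ _ hcard (shiftError_actsOn e ε c) _ (cosetState_mem e ε hD D.zero_mem)
    rw [trace_shiftError e ε hc₀, zero_div, zero_mul] at this
    exact hne (hstate ▸ this)
  · obtain ⟨t, ht⟩ := hdet _ _ hcard (shiftError_actsOn e ε c)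
    refine hne ?_
    rw [ht _ (cosetState_mem e ε hD hc) _ (cosetState_mem e ε hD D.zero_mem)]
    convert mul_zero t
    refine Finset.sum_eq_zero fun x _ => ?_
    by_cases h₁ : decodeWord e ε x - c ∈ dualCode D
    · have h₂ : decodeWord e ε x ∉ dualCode D := fun h₂ =>
        hcD (by simpa using (dualCode D).sub_mem h₂ h₁)
      simp [cosetState, h₂]
    · simp [cosetState, h₁]

theorem minDist_le_hammingNorm {D : Submodule F (ι → F)} {c : ι → F} (hc : c ∈ D) (hc₀ : c ≠ 0) :
    minDist D ≤ hammingNorm c :=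
  Nat.sInf_le ⟨c, hc, 0, D.zero_mem, hc₀, hammingDist_zero_right c⟩

end CSS

end SkewCode

theorem mainTheorem1
    (p m i : ℕ) (hp : p.Prime) (hm : 0 < m)
    {F : Type*} [Field F] [Fintype F] [DecidableEq F] (hF : Fintype.card F = p ^ m)
    (Θ : RingAut F) (hΘ : ∀ a : F, Θ a = a ^ p ^ i)
    (M : Matrix (Fin 2) (Fin 2) F) (γ : F) (hγ : γ ≠ 0)
    (hM : M * M.transpose = γ • (1 : Matrix (Fin 2) (Fin 2) F))
    (α β : ℕ) (hα : orderOf Θ ∣ α) (hβ : orderOf (thetaAut Θ) ∣ β)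
    (C : Submodule (MixedRing F) (MixedSpace F α β)) (hC : IsMixedSkewCyclic Θ C)
    (C' : Submodule F (Fin α → F)) (D : Submodule (MixedRing F) (Fin β → MixedRing F))
    (hsep : ∀ (x : Fin α → F) (y : Fin β → MixedRing F), (x, y) ∈ C ↔ x ∈ C' ∧ y ∈ D)
    (f h g₁ h₁ g₂ h₂ : SkewPoly Θ)
    (hf : IsGeneratedBy Θ C' f)
    (hg₁ : IsGeneratedBy Θ (componentOne D) g₁)
    (hg₂ : IsGeneratedBy Θ (componentTwo D) g₂)
    (hhf : xPowSubOne Θ α = h * f)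
    (hhg₁ : xPowSubOne Θ β = h₁ * g₁)
    (hhg₂ : xPowSubOne Θ β = h₂ * g₂)
    (hdiv : xPowSubOne Θ α ∣ᵣ dagger h * h)
    (hdiv₁ : xPowSubOne Θ β ∣ᵣ dagger h₁ * h₁)
    (hdiv₂ : xPowSubOne Θ β ∣ᵣ dagger h₂ * h₂) :
    ∃ k dH : ℕ, k = Module.finrank F (grayImage M C) ∧ dH = minDist (grayImage M C) ∧
      α + 2 * β ≤ 2 * k ∧
      ∃ Q : Submodule ℂ (QState (p ^ m) (α + 2 * β)),
        IsQuantumCode (2 * k - (α + 2 * β)) dH Q ∧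
        ((∃ c ∈ grayImage M C, c ≠ 0 ∧ hammingNorm c = dH ∧
            (c ∉ dualCode (grayImage M C) ∨ grayImage M C = dualCode (grayImage M C))) →
          ¬ IsQuantumCode (2 * k - (α + 2 * β)) (dH + 1) Q) := by
  have hΘα : Θ ^ α = 1 := orderOf_dvd_iff_pow_eq_one.1 hα
  have hΘβ : Θ ^ β = 1 := pow_eq_one_of_orderOf_thetaAut_dvd hβ
  have hdual : dualCode (grayImage M C) ≤ grayImage M C :=
    dualCode_grayImage_le hγ hM hsep (dualCode_le_of_rightDvd hΘα hf hhf hdiv)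
      (dualCode_le_of_rightDvd hΘβ hg₁ hhg₁ hdiv₁) (dualCode_le_of_rightDvd hΘβ hg₂ hhg₂ hdiv₂)
  have hcard : Fintype.card (Fin α ⊕ Fin β × Fin 2) = α + 2 * β := by
    simp [mul_comm]
  have e : F ≃ Fin (p ^ m) := Fintype.equivFinOfCardEq hF
  have ε : Fin (α + 2 * β) ≃ Fin α ⊕ Fin β × Fin 2 := (Fintype.equivFinOfCardEq hcard).symm
  -- For the zero code the distance bound is vacuous, so the value 0 of `minDist` does no harm.
  refine ⟨_, _, rfl, rfl, ?_, cssCode e ε (grayImage M C),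
    isQuantumCode_cssCode e ε hdual fun c hc hc₀ => minDist_le_hammingNorm hc hc₀, ?_⟩
  · have h₁ := finrank_add_finrank_dualCode (grayImage M C)
    have h₂ := Submodule.finrank_mono hdual
    omega
  · rintro ⟨c, hc, hc₀, hd, h⟩
    rw [← hd]
    exact not_isQuantumCode_cssCode e ε hdual hc hc₀ h
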